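/- Let $S,A,B$ be germs of holomorphic functions at a point $q_0\in\mathbb C^2$ (coordinates $x,y$) such that the solutions of the implicit cubic ODE $$p^3+S(x,y)\,p^2+A(x,y)\,p+B(x,y)=0,\qquad p=\frac{dy}{dx},\tag{1}$$ form a (possibly singular) $3$-web, i.e. there are points arbitrarily close to $q_0$ at which the three roots $p_1,p_2,p_3$ are pairwise distinct. Suppose that 1. the solution web of (1) admits the infinitesimal symmetry $X=w_x x\,\partial_x+w_y y\,\partial_y$ with $w_x,w_y\in\mathbb C$, $w_x\neq w_y$ (the local flow of $X$ near $q_0$ maps web directions to web directions); 2. $SA-B\neq 0$ at $q_0$, and near $q_0$ the coefficients satisfy $$S_x=\frac{(A^2-AS^2+2SB)S_y+(S^3-AS+2B)A_y-(A+S^2)B_y}{2AS-2B},\qquad A_x=\frac{-AS_y+SA_y+B_y}{2},$$ $$B_x=\frac{(A^3+4B^2-3ASB)S_y+(2AB-SA^2+BS^2)A_y+(2AS^2-3SB-A^2)B_y}{2AS-2B}.$$ Then there is a germ of a massive Frobenius $3$-fold $M$ with unity field $e$ and Euler field $E$ such that $\langle e,e\rangle=1$ and whose booklet $3$-web is the solution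 web of (1) near $q_0$; moreover $X$ is the projection of $E$ along $e$. Explicitly, there is a surface $\Sigma\subset M$ transverse to $e$, parametrized by a neighbourhood of $q_0$ in $\mathbb C^2$, such that at each of its points the directions cut on $\Sigma$ by the three planes $\mathrm{span}\{e,e_i\}$, where $e_1,e_2,e_3$ are the orthogonal idempotents of the tangent algebra, are the three directions of (1) (at points where the tangent algebra is not semi-simple: their limits from points where it is, with multiplicity), and $E-X$ is a multiple of $e$ along $\Sigma$. Here a Frobenius manifold is a complex manifold with a holomorphic commutative associative multiplication on its tangent spaces, a holomorphic non-degenerate flat inner product with $\langle u\cdot v,w\rangle=\langle u,v\cdot w\rangle$ and Levi-Civita connection $\nabla$, a unity field $e$ with $\nabla e=0$, and a holomorphic Euler field $E$ with $\nabla(\nabla E)=0$ whose flow rescales the multiplication and the inner product (their Lie derivatives along $E$ are constant multiples of them), such that $(\nabla_z c)(u,v,w)$, $c(u,v,w)=\langle u\cdot v,w\rangle$, is symmetric in $u,v,w,z$. A germ of it is massive if the tangent algebra is semi-simple on an open set having the base point in its closure. -/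

import Mathlib

open Filter Topology

/-! ### Webs of a cubic implicit ODE on `ℂ²`

Points of `ℂ²` are pairs `q = (x, y)`; tangent vectors are pairs `v = (dx, dy)`. -/

/-- The partial derivative `∂f/∂x` of a function of `(x, y) ∈ ℂ²`. -/
noncomputable def partialX (f : ℂ × ℂ → ℂ) (q : ℂ × ℂ) : ℂ := fderiv ℂ f q (1, 0)

/-- The partial derivative `∂f/∂y` of a function of `(x, y) ∈ ℂ²`. -/
noncomputable def partialY (f : ℂ × ℂ → ℂ) (q : ℂ × ℂ) : ℂ := fderiv ℂ f q (0, 1)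

/-- `v = (dx, dy)` is a direction (a tangent vector of a solution) at `q` of the implicit ODE
`p³ + S p² + A p + B = 0`, `p = dy/dx`, written homogeneously as
`dy³ + S dy² dx + A dy dx² + B dx³ = 0`. -/
def IsSolutionDirection (S A B : ℂ × ℂ → ℂ) (q v : ℂ × ℂ) : Prop :=
  v ≠ 0 ∧ v.2 ^ 3 + S q * v.2 ^ 2 * v.1 + A q * v.2 * v.1 ^ 2 + B q * v.1 ^ 3 = 0

/-- `p 0, p 1, p 2` are the roots, listed with multiplicity, of `T³ + S T² + A T + B` at `q`:
the slopes of the solution web at `q`. -/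
def IsSlopeTriple (S A B : ℂ × ℂ → ℂ) (q : ℂ × ℂ) (p : Fin 3 → ℂ) : Prop :=
  ∀ T : ℂ, T ^ 3 + S q * T ^ 2 + A q * T + B q = ∏ i, (T - p i)

/-- `q` is a regular point of the solution web: its three slopes are pairwise distinct. -/
def IsRegularPoint (S A B : ℂ × ℂ → ℂ) (q : ℂ × ℂ) : Prop :=
  ∃ p : Fin 3 → ℂ, IsSlopeTriple S A B q p ∧ Function.Injective p

/-- The vector field `X = wx x ∂x + wy y ∂y`. -/
def diagField (wx wy : ℂ) (q : ℂ × ℂ) : ℂ × ℂ := (wx * q.1, wy * q.2)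

/-- The flow of `X = wx x ∂x + wy y ∂y` at (complex) time `τ`. -/
noncomputable def diagFlow (wx wy τ : ℂ) (q : ℂ × ℂ) : ℂ × ℂ :=
  (Complex.exp (wx * τ) * q.1, Complex.exp (wy * τ) * q.2)

theorem diagFlow_zero (wx wy : ℂ) (q : ℂ × ℂ) : diagFlow wx wy 0 q = q := by
  simp [diagFlow]

theorem hasDerivAt_diagFlow (wx wy τ : ℂ) (q : ℂ × ℂ) :
    HasDerivAt (fun s => diagFlow wx wy s q) (diagField wx wy (diagFlow wx wy τ q)) τ := by
  have h : ∀ w c : ℂ, HasDerivAt (fun s => Complex.exp (w * s) * c)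
      (w * (Complex.exp (w * τ) * c)) τ := by
    intro w c
    have h1 : HasDerivAt (fun s : ℂ => w * s) w τ := by
      simpa using (hasDerivAt_id τ).const_mul w
    have h2 := (h1.cexp).mul_const c
    exact h2.congr_deriv (by ring)
  exact (h wx q.1).prodMk (h wy q.2)

/-- `X = wx x ∂x + wy y ∂y` is an infinitesimal symmetry, near `q₀`, of the solution web: the
differentials of its local flow carry the web directions exactly to the web directions. -/
def IsInfinitesimalSymmetry (S A B : ℂ × ℂ → ℂ) (wx wy : ℂ) (q₀ : ℂ × ℂ) : Prop :=
  ∀ᶠ z : ℂ × (ℂ × ℂ) in 𝓝 (0, q₀), ∀ v : ℂ × ℂ,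
    IsSolutionDirection S A B z.2 v ↔
      IsSolutionDirection S A B (diagFlow wx wy z.1 z.2) (fderiv ℂ (diagFlow wx wy z.1) z.2 v)

/-- The system of hydrodynamic type for the coefficients `S, A, B`, at the point `q`
(to be used where `A S - B ≠ 0`). -/
def SatisfiesHydrodynamicSystem (S A B : ℂ × ℂ → ℂ) (q : ℂ × ℂ) : Prop :=
  partialX S q =
      ((A q ^ 2 - A q * S q ^ 2 + 2 * S q * B q) * partialY S q
        + (S q ^ 3 - A q * S q + 2 * B q) * partialY A q
        - (A q + S q ^ 2) * partialY B q) / (2 * A q * S q - 2 * B q) ∧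
  partialX A q = (-(A q) * partialY S q + S q * partialY A q + partialY B q) / 2 ∧
  partialX B q =
      ((A q ^ 3 + 4 * B q ^ 2 - 3 * A q * S q * B q) * partialY S q
        + (2 * A q * B q - S q * A q ^ 2 + B q * S q ^ 2) * partialY A q
        + (2 * A q * S q ^ 2 - 3 * S q * B q - A q ^ 2) * partialY B q)
        / (2 * A q * S q - 2 * B q)

/-! ### Frobenius structures on open subsets of a complex vector space -/

/-- A Frobenius manifold whose underlying complex manifold is an open subset `carrier` of a
complex vector space `V` (every germ of a complex manifold has such a representative). All
tangent spaces are identified with `V`; the coordinates of `V` need not be flat. Values of the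
fields outside `carrier` are irrelevant. -/
structure FrobeniusStructure (V : Type*) [NormedAddCommGroup V] [NormedSpace ℂ V] where
  /-- the underlying manifold -/
  carrier : Set V
  isOpen_carrier : IsOpen carrier
  /-- the multiplication `mul p u v = u · v` on the tangent space at `p` -/
  mul : V → V →L[ℂ] V →L[ℂ] V
  /-- the inner product `metric p u v = ⟨u, v⟩` on the tangent space at `p` -/
  metric : V → V →L[ℂ] V →L[ℂ] ℂ
  /-- the Christoffel tensor of the connection: `∇_u W = D_u W + conn p u W` -/
  conn : V → V →L[ℂ] V →L[ℂ] V
  /-- the unity vector field `e` -/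
  unity : V → V
  /-- the Euler vector field `E` -/
  euler : V → V
  analytic_mul : AnalyticOnNhd ℂ mul carrier
  analytic_metric : AnalyticOnNhd ℂ metric carrier
  analytic_conn : AnalyticOnNhd ℂ conn carrier
  analytic_unity : AnalyticOnNhd ℂ unity carrier
  analytic_euler : AnalyticOnNhd ℂ euler carrier
  mul_comm : ∀ p ∈ carrier, ∀ u v, mul p u v = mul p v u
  mul_assoc : ∀ p ∈ carrier, ∀ u v w, mul p (mul p u v) w = mul p u (mul p v w)
  metric_symm : ∀ p ∈ carrier, ∀ u v, metric p u v = metric p v u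
  metric_nondegenerate : ∀ p ∈ carrier, ∀ u, (∀ v, metric p u v = 0) → u = 0
  metric_invariant : ∀ p ∈ carrier, ∀ u v w, metric p (mul p u v) w = metric p u (mul p v w)
  /-- `∇` is the Levi-Civita connection of the metric: torsion-free ... -/
  conn_symm : ∀ p ∈ carrier, ∀ u v, conn p u v = conn p v u
  /-- ... and metric: `∇ g = 0` -/
  conn_metric : ∀ p ∈ carrier, ∀ z u v,
    fderiv ℂ metric p z u v = metric p (conn p z u) v + metric p u (conn p z v)
  /-- the metric is flat: the Riemann curvature `R(u, v) w` vanishes -/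
  flat : ∀ p ∈ carrier, ∀ u v w,
    fderiv ℂ conn p u v w - fderiv ℂ conn p v u w
      + conn p u (conn p v w) - conn p v (conn p u w) = 0
  unity_mul : ∀ p ∈ carrier, ∀ v, mul p (unity p) v = v
  /-- `∇ e = 0` -/
  unity_parallel : ∀ p ∈ carrier, ∀ u, fderiv ℂ unity p u + conn p u (unity p) = 0
  /-- `∇ (∇ E) = 0`, where `∇ E` is the field of endomorphisms `v ↦ D_v E + conn v E` -/
  euler_linear : ∀ p ∈ carrier, ∀ u v,
    fderiv ℂ (fun r => fderiv ℂ euler r + (conn r).flip (euler r)) p u v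
      + conn p u (fderiv ℂ euler p v + conn p v (euler p))
      - (fderiv ℂ euler p (conn p u v) + conn p (conn p u v) (euler p)) = 0
  /-- the flow of `E` rescales the multiplication: its Lie derivative along `E` is a constant
  multiple of it -/
  euler_mul : ∃ k : ℂ, ∀ p ∈ carrier, ∀ u v,
    fderiv ℂ mul p (euler p) u v - fderiv ℂ euler p (mul p u v)
      + mul p (fderiv ℂ euler p u) v + mul p u (fderiv ℂ euler p v) = k • mul p u v
  /-- the flow of `E` rescales the inner product: its Lie derivative along `E` is a constant
  multiple of it -/
  euler_metric : ∃ k : ℂ, ∀ p ∈ carrier, ∀ u v,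
    fderiv ℂ metric p (euler p) u v
      + metric p (fderiv ℂ euler p u) v + metric p u (fderiv ℂ euler p v) = k * metric p u v
  /-- the 4-tensor `(∇_z c)(u, v, w)`, `c(u, v, w) = ⟨u · v, w⟩`, is symmetric. It is visibly
  symmetric in `u, v, w` (as `c` is), so exchanging `z` and `u` is what is left. The
  left-hand side is `(∇_z c)(u, v, w)`, the right-hand side `(∇_u c)(z, v, w)`. -/
  potential : ∀ p ∈ carrier, ∀ z u v w,
    fderiv ℂ (fun r => metric r (mul r u v) w) p z
        - metric p (mul p (conn p z u) v) w - metric p (mul p u (conn p z v)) w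
        - metric p (mul p u v) (conn p z w)
      = fderiv ℂ (fun r => metric r (mul r z v) w) p u
        - metric p (mul p (conn p u z) v) w - metric p (mul p z (conn p u v)) w
        - metric p (mul p z v) (conn p u w)

namespace FrobeniusStructure

variable {V : Type*} [NormedAddCommGroup V] [NormedSpace ℂ V]

/-- `b` is a basis of the tangent space at `p` consisting of orthogonal idempotents
`e₁, e₂, e₃`, i.e. the tangent algebra is the direct product of the lines `ℂ e_i`. -/
def IsIdempotentBasis (F : FrobeniusStructure V) (p : V) (b : Module.Basis (Fin 3) ℂ V) : Prop :=
  ∀ i j, F.mul p (b i) (b j) = if i = j then b i else 0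

/-- The tangent algebra at `p` (of a Frobenius 3-fold) is semi-simple. -/
def IsSemisimpleAt (F : FrobeniusStructure V) (p : V) : Prop :=
  ∃ b : Module.Basis (Fin 3) ℂ V, F.IsIdempotentBasis p b

/-- The germ at `p₀` is massive: the tangent algebras are semi-simple at all points of some
open subset of the manifold having `p₀` in its closure. -/
def IsMassiveAt (F : FrobeniusStructure V) (p₀ : V) : Prop :=
  ∃ O : Set V, IsOpen O ∧ O ⊆ F.carrier ∧ p₀ ∈ closure O ∧ ∀ p ∈ O, F.IsSemisimpleAt p

/-- A parametrized surface `ι : U → M`, `U ⊆ ℂ²` open, transverse to the unity field `e`. -/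
structure TransverseSurface (F : FrobeniusStructure V) where
  /-- the parameter domain -/
  U : Set (ℂ × ℂ)
  isOpen_U : IsOpen U
  /-- the parametrization -/
  ι : ℂ × ℂ → V
  analytic_ι : AnalyticOnNhd ℂ ι U
  mapsTo_ι : Set.MapsTo ι U F.carrier
  injOn_ι : Set.InjOn ι U
  immersion : ∀ q ∈ U, Function.Injective (fderiv ℂ ι q)
  transverse : ∀ q ∈ U, F.unity (ι q) ∉ Set.range (fderiv ℂ ι q)

/-- `d 0, d 1, d 2` are the three directions cut on the surface, at a point `q` over which the
tangent algebra is semi-simple, by the planes spanned by `e` and `e_i`. -/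
def TransverseSurface.IsRegularBookletTriple {F : FrobeniusStructure V}
    (W : F.TransverseSurface) (q : ℂ × ℂ) (d : Fin 3 → ℂ × ℂ) : Prop :=
  ∃ b : Module.Basis (Fin 3) ℂ V, F.IsIdempotentBasis (W.ι q) b ∧
    ∀ i, d i ≠ 0 ∧
      fderiv ℂ W.ι q (d i) ∈ Submodule.span ℂ ({F.unity (W.ι q), b i} : Set V)

/-- `d 0, d 1, d 2` are the three directions, with multiplicity, of the booklet web at an
arbitrary point `q` of the surface: `q` is in the closure of the set of points of the surface
with semi-simple tangent algebra, and `d` is the limit of the (unordered) triples of directions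
at such points `q'` as `q' → q`. -/
def TransverseSurface.IsBookletTriple {F : FrobeniusStructure V}
    (W : F.TransverseSurface) (q : ℂ × ℂ) (d : Fin 3 → ℂ × ℂ) : Prop :=
  (∀ i, d i ≠ 0) ∧
  q ∈ closure {q' ∈ W.U | F.IsSemisimpleAt (W.ι q')} ∧
  ∀ N ∈ 𝓝 d, ∀ᶠ q' in 𝓝 q, F.IsSemisimpleAt (W.ι q') →
    ∃ d' ∈ N, W.IsRegularBookletTriple q' d'

/-- The booklet web cut on the surface is the solution web of `p³ + S p² + A p + B = 0`: at every
point the directions `(1, p i)` given by the roots `p i`, with multiplicity, are those of the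
booklet web, and where the tangent algebra is semi-simple they are exactly the directions cut by
the planes spanned by `e` and `e_i`. -/
def TransverseSurface.BookletWebEq {F : FrobeniusStructure V}
    (W : F.TransverseSurface) (S A B : ℂ × ℂ → ℂ) : Prop :=
  ∀ q ∈ W.U, ∀ p : Fin 3 → ℂ, IsSlopeTriple S A B q p →
    W.IsBookletTriple q (fun i => (1, p i)) ∧
    (F.IsSemisimpleAt (W.ι q) → W.IsRegularBookletTriple q (fun i => (1, p i)))

end FrobeniusStructure

set_option synthInstance.maxHeartbeats 400000

/-! ### The Frobenius structure of a normalized potential `t³/6 + t x y + f(x, y)` -/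

/-! The Frobenius manifold is written in flat coordinates `(t, x, y)` with unity `∂t`, metric `dt² +
2 dx dy` and potential `t³/6 + t x y + f(x, y)`. Put `a, b, c, d = f_xxx, f_xxy, f_xyy, f_yyy`.
Associativity is then the single equation `a d - b c = 1`, and the planes spanned by `∂t` and the
idempotents cut the surface `t = 0` in the roots of `d p³ + c p² - b p - a = 0`. To obtain the given
cubic one takes `d = k`, `c = S k`, `b = -A k`, `a = -B k`; associativity becomes `k² (S A - B) =
1`, which has an analytic solution because `S A - B ≠ 0` at `q₀`
(`exists_analyticAt_sq_mul_eq_one`).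

With this `k` the hydrodynamic system yields the closedness relations `a_y = b_x`, `b_y = c_x`, `c_y
= d_x`. Only third derivatives enter the Frobenius structure, so `f` itself is never integrated
(`PotentialData.ofCubic`, `PotentialData.frobenius`).

The Euler field comes from the symmetry: the flow of `X` multiplies all slopes by `exp((wy - wx)
τ)`, so `S, A, B` are homogeneous of weights 1, 2, 3 in units of `wy - wx`. This is proved at
regular points (`fderiv_diagField_of_isRegularPoint`) and extended by density.

The web is identified through explicit eigenvectors. For a root `p`, the vector `(1, k(p+S), k p
(p+S))` spans an ideal of the tangent algebra (`cubicMul_slopeVector`), and modulo `∂t` it points in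
the direction `(1, p)`. The algebra is semi-simple exactly where the roots are distinct; elsewhere
the directions are limits, by continuity of the unordered triple of roots
(`IsSlopeTriple.eventually_exists`). -/

theorem fderiv_apply_eq_partial (f : ℂ × ℂ → ℂ) (q z : ℂ × ℂ) :
    fderiv ℂ f q z = z.1 * partialX f q + z.2 * partialY f q := by
  have h : z = z.1 • ((1, 0) : ℂ × ℂ) + z.2 • ((0, 1) : ℂ × ℂ) := by
    ext <;> simp
  conv_lhs => rw [h]
  rw [map_add, map_smul, map_smul]
  rfl

/-- The coordinate functional `dt` of `ℂ × ℂ × ℂ`. -/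
noncomputable def coordT : ℂ × ℂ × ℂ →L[ℂ] ℂ := ContinuousLinearMap.fst ℂ ℂ (ℂ × ℂ)

/-- The coordinate functional `dx` of `ℂ × ℂ × ℂ`. -/
noncomputable def coordX : ℂ × ℂ × ℂ →L[ℂ] ℂ :=
  (ContinuousLinearMap.fst ℂ ℂ ℂ).comp (ContinuousLinearMap.snd ℂ ℂ (ℂ × ℂ))

/-- The coordinate functional `dy` of `ℂ × ℂ × ℂ`. -/
noncomputable def coordY : ℂ × ℂ × ℂ →L[ℂ] ℂ :=
  (ContinuousLinearMap.snd ℂ ℂ ℂ).comp (ContinuousLinearMap.snd ℂ ℂ (ℂ × ℂ))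

@[simp] theorem coordT_apply (u : ℂ × ℂ × ℂ) : coordT u = u.1 := rfl
@[simp] theorem coordX_apply (u : ℂ × ℂ × ℂ) : coordX u = u.2.1 := rfl
@[simp] theorem coordY_apply (u : ℂ × ℂ × ℂ) : coordY u = u.2.2 := rfl

/-- The metric `dt² + 2 dx dy`. -/
noncomputable def nullMetric : ℂ × ℂ × ℂ →L[ℂ] ℂ × ℂ × ℂ →L[ℂ] ℂ :=
  coordT.smulRight coordT + coordX.smulRight coordY + coordY.smulRight coordX

@[simp] theorem nullMetric_apply (u v : ℂ × ℂ × ℂ) :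
    nullMetric u v = u.1 * v.1 + u.2.1 * v.2.2 + u.2.2 * v.2.1 := by
  simp [nullMetric]

/-- The bilinear map `(u, v) ↦ φ u * ψ v • w`. -/
noncomputable def bilinMonomial (φ ψ : ℂ × ℂ × ℂ →L[ℂ] ℂ) (w : ℂ × ℂ × ℂ) :
    ℂ × ℂ × ℂ →L[ℂ] ℂ × ℂ × ℂ →L[ℂ] ℂ × ℂ × ℂ :=
  φ.smulRight (ψ.smulRight w)

@[simp] theorem bilinMonomial_apply (φ ψ : ℂ × ℂ × ℂ →L[ℂ] ℂ) (w u v : ℂ × ℂ × ℂ) :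
    bilinMonomial φ ψ w u v = (φ u * ψ v) • w := by
  simp [bilinMonomial, smul_smul]

section AffineFamilies

variable {V E F : Type*} [NormedAddCommGroup V] [NormedSpace ℂ V]
  [NormedAddCommGroup E] [NormedSpace ℂ E] [NormedAddCommGroup F] [NormedSpace ℂ F]

theorem analyticAt_affine_family {f₁ f₂ f₃ f₄ : E → ℂ} {x : E}
    (h₁ : AnalyticAt ℂ f₁ x) (h₂ : AnalyticAt ℂ f₂ x) (h₃ : AnalyticAt ℂ f₃ x)
    (h₄ : AnalyticAt ℂ f₄ x) (m m₁ m₂ m₃ m₄ : F) :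
    AnalyticAt ℂ (fun r => m + f₁ r • m₁ + f₂ r • m₂ + f₃ r • m₃ + f₄ r • m₄) x :=
  (((analyticAt_const.add (h₁.smul analyticAt_const)).add (h₂.smul analyticAt_const)).add
    (h₃.smul analyticAt_const)).add (h₄.smul analyticAt_const)

theorem fderiv_affine_family_apply {f₁ f₂ f₃ f₄ : E → ℂ} {f₁' f₂' f₃' f₄' : E →L[ℂ] ℂ} {x : E}
    (h₁ : HasFDerivAt f₁ f₁' x) (h₂ : HasFDerivAt f₂ f₂' x) (h₃ : HasFDerivAt f₃ f₃' x)
    (h₄ : HasFDerivAt f₄ f₄' x) (m m₁ m₂ m₃ m₄ : F) (z : E) :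
    fderiv ℂ (fun r => m + f₁ r • m₁ + f₂ r • m₂ + f₃ r • m₃ + f₄ r • m₄) x z =
      f₁' z • m₁ + f₂' z • m₂ + f₃' z • m₃ + f₄' z • m₄ := by
  have h := ((((h₁.smul_const m₁).const_add m).add (h₂.smul_const m₂)).add
    (h₃.smul_const m₃)).add (h₄.smul_const m₄)
  have h' : HasFDerivAt (fun r => m + f₁ r • m₁ + f₂ r • m₂ + f₃ r • m₃ + f₄ r • m₄) _ x := h
  rw [h'.fderiv]
  simp

theorem fderiv_pairing_apply {g : V →L[ℂ] V →L[ℂ] ℂ} {m : E → V →L[ℂ] V →L[ℂ] V} {x : E}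
    (hm : DifferentiableAt ℂ m x) (z : E) (u v w : V) :
    fderiv ℂ (fun r => g (m r u v) w) x z = g (fderiv ℂ m x z u v) w := by
  have h2 := (hm.hasFDerivAt.clm_apply (hasFDerivAt_const u x)).clm_apply (hasFDerivAt_const v x)
  have h3 := (g.hasFDerivAt.comp x h2).clm_apply (hasFDerivAt_const w x)
  have h4 : HasFDerivAt (fun r => g (m r u v) w) _ x := h3
  rw [h4.fderiv]
  simp

end AffineFamilies

/-- The part of the multiplication that is determined by the unity `∂t`. -/
noncomputable def mulUnit : ℂ × ℂ × ℂ →L[ℂ] ℂ × ℂ × ℂ →L[ℂ] ℂ × ℂ × ℂ :=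
  bilinMonomial coordT coordT (1, 0, 0) + bilinMonomial coordX coordY (1, 0, 0)
    + bilinMonomial coordY coordX (1, 0, 0) + bilinMonomial coordT coordX (0, 1, 0)
    + bilinMonomial coordX coordT (0, 1, 0) + bilinMonomial coordT coordY (0, 0, 1)
    + bilinMonomial coordY coordT (0, 0, 1)

/-- The bilinear map with which `f_xxx` enters the multiplication. -/
noncomputable def mulXXX : ℂ × ℂ × ℂ →L[ℂ] ℂ × ℂ × ℂ →L[ℂ] ℂ × ℂ × ℂ :=
  bilinMonomial coordX coordX (0, 0, 1)

/-- The bilinear map with which `f_xxy` enters the multiplication. -/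
noncomputable def mulXXY : ℂ × ℂ × ℂ →L[ℂ] ℂ × ℂ × ℂ →L[ℂ] ℂ × ℂ × ℂ :=
  bilinMonomial coordX coordX (0, 1, 0) + bilinMonomial coordX coordY (0, 0, 1)
    + bilinMonomial coordY coordX (0, 0, 1)

/-- The bilinear map with which `f_xyy` enters the multiplication. -/
noncomputable def mulXYY : ℂ × ℂ × ℂ →L[ℂ] ℂ × ℂ × ℂ →L[ℂ] ℂ × ℂ × ℂ :=
  bilinMonomial coordX coordY (0, 1, 0) + bilinMonomial coordY coordX (0, 1, 0)
    + bilinMonomial coordY coordY (0, 0, 1)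

/-- The bilinear map with which `f_yyy` enters the multiplication. -/
noncomputable def mulYYY : ℂ × ℂ × ℂ →L[ℂ] ℂ × ℂ × ℂ →L[ℂ] ℂ × ℂ × ℂ :=
  bilinMonomial coordY coordY (0, 1, 0)

/-- The multiplication with unity `∂t` whose structure constants with respect to
`dt² + 2 dx dy` are `a = f_xxx, b = f_xxy, c = f_xyy, d = f_yyy`. -/
noncomputable def nullMul (a b c d : ℂ) :
    ℂ × ℂ × ℂ →L[ℂ] ℂ × ℂ × ℂ →L[ℂ] ℂ × ℂ × ℂ :=
  mulUnit + a • mulXXX + b • mulXXY + c • mulXYY + d • mulYYY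

theorem nullMul_apply (a b c d : ℂ) (u v : ℂ × ℂ × ℂ) :
    nullMul a b c d u v =
      (u.1 * v.1 + u.2.1 * v.2.2 + u.2.2 * v.2.1,
       u.1 * v.2.1 + u.2.1 * v.1 + b * (u.2.1 * v.2.1)
          + c * (u.2.1 * v.2.2 + u.2.2 * v.2.1) + d * (u.2.2 * v.2.2),
       u.1 * v.2.2 + u.2.2 * v.1 + a * (u.2.1 * v.2.1)
          + b * (u.2.1 * v.2.2 + u.2.2 * v.2.1) + c * (u.2.2 * v.2.2)) := by
  ext <;> simp [nullMul, mulUnit, mulXXX, mulXXY, mulXYY, mulYYY] <;> ring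

/-- The vector field `E = wt t ∂t + wx x ∂x + wy y ∂y`. -/
noncomputable def linearEuler (wt wx wy : ℂ) : ℂ × ℂ × ℂ →L[ℂ] ℂ × ℂ × ℂ :=
  coordT.smulRight (wt, 0, 0) + coordX.smulRight (0, wx, 0) + coordY.smulRight (0, 0, wy)

theorem linearEuler_apply (wt wx wy : ℂ) (u : ℂ × ℂ × ℂ) :
    linearEuler wt wx wy u = (wt * u.1, wx * u.2.1, wy * u.2.2) := by
  ext <;> simp [linearEuler, mul_comm]

/-- The third derivatives `a = f_xxx, b = f_xxy, c = f_xyy, d = f_yyy` of a potential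
`t³/6 + t x y + f(x, y)` on an open set: they are closed, satisfy the associativity equation
`a d - b c = 1`, and are quasi-homogeneous with weights `wx, wy` of `x, y`. -/
structure PotentialData (wx wy : ℂ) where
  U : Set (ℂ × ℂ)
  isOpen_U : IsOpen U
  a : ℂ × ℂ → ℂ
  b : ℂ × ℂ → ℂ
  c : ℂ × ℂ → ℂ
  d : ℂ × ℂ → ℂ
  analytic_a : AnalyticOnNhd ℂ a U
  analytic_b : AnalyticOnNhd ℂ b U
  analytic_c : AnalyticOnNhd ℂ c U
  analytic_d : AnalyticOnNhd ℂ d U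
  closed_ab : ∀ q ∈ U, partialY a q = partialX b q
  closed_bc : ∀ q ∈ U, partialY b q = partialX c q
  closed_cd : ∀ q ∈ U, partialY c q = partialX d q
  assoc : ∀ q ∈ U, a q * d q - b q * c q = 1
  hom_a : ∀ q ∈ U, fderiv ℂ a q (diagField wx wy q) = 3 / 2 * (wy - wx) * a q
  hom_b : ∀ q ∈ U, fderiv ℂ b q (diagField wx wy q) = 1 / 2 * (wy - wx) * b q
  hom_c : ∀ q ∈ U, fderiv ℂ c q (diagField wx wy q) = -1 / 2 * (wy - wx) * c q
  hom_d : ∀ q ∈ U, fderiv ℂ d q (diagField wx wy q) = -3 / 2 * (wy - wx) * d q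

namespace PotentialData

variable {wx wy : ℂ} (P : PotentialData wx wy)

/-- The multiplication on the tangent spaces of `ℂ × U` defined by a potential. -/
noncomputable def mul (p : ℂ × ℂ × ℂ) : ℂ × ℂ × ℂ →L[ℂ] ℂ × ℂ × ℂ →L[ℂ] ℂ × ℂ × ℂ :=
  nullMul (P.a p.2) (P.b p.2) (P.c p.2) (P.d p.2)

theorem analyticOnNhd_mul : AnalyticOnNhd ℂ P.mul {p | p.2 ∈ P.U} := by
  intro p hp
  have ha := (P.analytic_a p.2 hp).comp (analyticAt_snd (𝕜 := ℂ) (p := p))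
  have hb := (P.analytic_b p.2 hp).comp (analyticAt_snd (𝕜 := ℂ) (p := p))
  have hc := (P.analytic_c p.2 hp).comp (analyticAt_snd (𝕜 := ℂ) (p := p))
  have hd := (P.analytic_d p.2 hp).comp (analyticAt_snd (𝕜 := ℂ) (p := p))
  exact analyticAt_affine_family ha hb hc hd mulUnit mulXXX mulXXY mulXYY mulYYY

theorem fderiv_mul_apply {p : ℂ × ℂ × ℂ} (hp : p.2 ∈ P.U) (z u v : ℂ × ℂ × ℂ) :
    fderiv ℂ P.mul p z u v = fderiv ℂ P.a p.2 z.2 • mulXXX u v + fderiv ℂ P.b p.2 z.2 • mulXXY u v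
      + fderiv ℂ P.c p.2 z.2 • mulXYY u v + fderiv ℂ P.d p.2 z.2 • mulYYY u v := by
  have key : ∀ f : ℂ × ℂ → ℂ, AnalyticAt ℂ f p.2 → HasFDerivAt (fun r : ℂ × ℂ × ℂ => f r.2)
      ((fderiv ℂ f p.2).comp (ContinuousLinearMap.snd ℂ ℂ (ℂ × ℂ))) p := fun f hf =>
    hf.differentiableAt.hasFDerivAt.comp p (ContinuousLinearMap.snd ℂ ℂ (ℂ × ℂ)).hasFDerivAt
  have h := fderiv_affine_family_apply (key P.a (P.analytic_a _ hp)) (key P.b (P.analytic_b _ hp))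
    (key P.c (P.analytic_c _ hp)) (key P.d (P.analytic_d _ hp))
    mulUnit mulXXX mulXXY mulXYY mulYYY z
  exact congrArg (fun m : ℂ × ℂ × ℂ →L[ℂ] ℂ × ℂ × ℂ →L[ℂ] ℂ × ℂ × ℂ => m u v) h

theorem fderiv_nullMetric_mul_apply {p : ℂ × ℂ × ℂ} (hp : p.2 ∈ P.U) (z u v w : ℂ × ℂ × ℂ) :
    fderiv ℂ (fun r => nullMetric (P.mul r u v) w) p z = nullMetric (fderiv ℂ P.mul p z u v) w :=
  fderiv_pairing_apply (P.analyticOnNhd_mul p hp).differentiableAt z u v w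

/-- The Frobenius manifold defined by a potential. -/
noncomputable def frobenius : FrobeniusStructure (ℂ × ℂ × ℂ) where
  carrier := {p | p.2 ∈ P.U}
  isOpen_carrier := P.isOpen_U.preimage continuous_snd
  mul := P.mul
  metric := fun _ => nullMetric
  conn := fun _ => 0
  unity := fun _ => (1, 0, 0)
  euler := linearEuler ((wx + wy) / 2) wx wy
  analytic_mul := P.analyticOnNhd_mul
  analytic_metric := analyticOnNhd_const
  analytic_conn := analyticOnNhd_const
  analytic_unity := analyticOnNhd_const
  analytic_euler := ContinuousLinearMap.analyticOnNhd _ _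
  mul_comm p _ u v := by
    simp only [mul, nullMul_apply, Prod.mk.injEq]
    refine ⟨?_, ?_, ?_⟩ <;> ring
  mul_assoc p hp u v w := by
    have h := P.assoc _ hp
    simp only [mul, nullMul_apply, Prod.mk.injEq]
    -- The `t`-component is associative for any `a, b, c, d`; the other two fail by multiples of `a
    -- d - b c - 1`.
    refine ⟨?_, ?_, ?_⟩
    · ring
    · linear_combination -(u.2.2 * v.2.1 * w.2.1 - u.2.1 * v.2.1 * w.2.2) * h
    · linear_combination -(u.2.1 * v.2.2 * w.2.2 - u.2.2 * v.2.2 * w.2.1) * h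
  metric_symm p _ u v := by
    simp only [nullMetric_apply]; ring
  metric_nondegenerate p _ u h := by
    have h0 := h (1, 0, 0)
    have h1 := h (0, 1, 0)
    have h2 := h (0, 0, 1)
    simp only [nullMetric_apply] at h0 h1 h2
    ext
    · simpa using h0
    · simpa using h2
    · simpa using h1
  metric_invariant p _ u v w := by
    simp only [mul, nullMul_apply, nullMetric_apply]; ring
  conn_symm p _ u v := by simp
  conn_metric p _ z u v := by simp
  flat p _ u v w := by simp
  unity_mul p _ v := by
    ext <;> simp [mul, nullMul_apply]
  unity_parallel p _ u := by simp
  euler_linear p _ u v := by simp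
  euler_mul := by
    -- The product `∂t · ∂t = ∂t` forces the constant to be the weight of `t`, and the `t`-component
    -- of `∂x · ∂y` forces it to be `wx + wy` minus that weight. The remaining components are the
    -- homogeneity of `a, b, c, d`.
    refine ⟨(wx + wy) / 2, fun p hp u v => ?_⟩
    have hz : (linearEuler ((wx + wy) / 2) wx wy p).2 = diagField wx wy p.2 := by
      rw [linearEuler_apply]; rfl
    rw [P.fderiv_mul_apply hp, hz, P.hom_a _ hp, P.hom_b _ hp, P.hom_c _ hp, P.hom_d _ hp]
    simp only [ContinuousLinearMap.fderiv, linearEuler_apply, mul, nullMul_apply]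
    ext <;> simp [mulXXX, mulXXY, mulXYY, mulYYY] <;> ring
  euler_metric := by
    refine ⟨wx + wy, fun p _ u v => ?_⟩
    simp only [ContinuousLinearMap.fderiv, linearEuler_apply, nullMetric_apply]
    simp
    ring
  potential p hp z u v w := by
    -- The connection vanishes, so the claim is the symmetry of the fourth derivatives of `f`, which
    -- the closedness relations express.
    simp only [P.fderiv_nullMetric_mul_apply hp, P.fderiv_mul_apply hp, fderiv_apply_eq_partial,
      P.closed_ab _ hp, P.closed_bc _ hp, P.closed_cd _ hp]
    simp [mulXXX, mulXXY, mulXYY, mulYYY]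
    ring

end PotentialData

/-! ### Slopes: Vieta's formulas, existence, discriminant and continuity -/

/-- The discriminant of `T³ + S T² + A T + B` at `q`. -/
noncomputable def cubicDisc (S A B : ℂ × ℂ → ℂ) (q : ℂ × ℂ) : ℂ :=
  S q ^ 2 * A q ^ 2 - 4 * A q ^ 3 - 4 * S q ^ 3 * B q - 27 * B q ^ 2 + 18 * S q * A q * B q

section Slopes

variable {S A B : ℂ × ℂ → ℂ} {q : ℂ × ℂ} {p : Fin 3 → ℂ}

theorem isSlopeTriple_iff : IsSlopeTriple S A B q p ↔
    S q = -(p 0 + p 1 + p 2) ∧ A q = p 0 * p 1 + p 1 * p 2 + p 0 * p 2 ∧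
      B q = -(p 0 * p 1 * p 2) := by
  constructor
  · intro h
    -- Three values of `T` determine the three coefficients: 0 gives the constant term, half the sum
    -- and half the difference at `±1` give the others.
    have h0 := h 0
    have h1 := h 1
    have h2 := h (-1)
    simp only [Fin.prod_univ_three] at h0 h1 h2
    refine ⟨?_, ?_, ?_⟩
    · linear_combination (1 / 2 : ℂ) * h1 + (1 / 2 : ℂ) * h2 - h0
    · linear_combination (1 / 2 : ℂ) * h1 - (1 / 2 : ℂ) * h2
    · linear_combination h0
  · rintro ⟨hS, hA, hB⟩ T
    rw [hS, hA, hB, Fin.prod_univ_three]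
    ring

/-- Three distinct roots of a cubic are its slope triple. -/
theorem isSlopeTriple_of_injective (hp : Function.Injective p)
    (h : ∀ i, p i ^ 3 + S q * p i ^ 2 + A q * p i + B q = 0) : IsSlopeTriple S A B q p := by
  have h01 : p 0 - p 1 ≠ 0 := sub_ne_zero.2 fun e => by simpa using hp e
  have h02 : p 0 - p 2 ≠ 0 := sub_ne_zero.2 fun e => by simpa using hp e
  have h12 : p 1 - p 2 ≠ 0 := sub_ne_zero.2 fun e => by simpa using hp e
  -- `e1`, `e2` are first divided differences of the cubic at the roots and `e3` is the second one.
  have e1 : p 0 ^ 2 + p 0 * p 1 + p 1 ^ 2 + S q * (p 0 + p 1) + A q = 0 := by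
    apply mul_left_cancel₀ h01
    linear_combination h 0 - h 1
  have e2 : p 0 ^ 2 + p 0 * p 2 + p 2 ^ 2 + S q * (p 0 + p 2) + A q = 0 := by
    apply mul_left_cancel₀ h02
    linear_combination h 0 - h 2
  have e3 : p 0 + p 1 + p 2 + S q = 0 := by
    apply mul_left_cancel₀ h12
    linear_combination e1 - e2
  rw [isSlopeTriple_iff]
  refine ⟨by linear_combination e3, ?_, ?_⟩
  · linear_combination e1 - (p 0 + p 1) * e3
  · linear_combination h 0 - p 0 * e1 + p 0 * p 1 * e3

theorem IsSlopeTriple.cubicDisc_eq (h : IsSlopeTriple S A B q p) :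
    cubicDisc S A B q = ((p 0 - p 1) * (p 0 - p 2) * (p 1 - p 2)) ^ 2 := by
  obtain ⟨hS, hA, hB⟩ := isSlopeTriple_iff.1 h
  rw [cubicDisc, hS, hA, hB]
  ring

theorem IsSlopeTriple.injective_iff (h : IsSlopeTriple S A B q p) :
    Function.Injective p ↔ cubicDisc S A B q ≠ 0 := by
  rw [h.cubicDisc_eq]
  constructor
  · intro hp
    have h01 : p 0 - p 1 ≠ 0 := sub_ne_zero.2 fun e => by simpa using hp e
    have h02 : p 0 - p 2 ≠ 0 := sub_ne_zero.2 fun e => by simpa using hp e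
    have h12 : p 1 - p 2 ≠ 0 := sub_ne_zero.2 fun e => by simpa using hp e
    positivity
  · intro hd
    simp only [ne_eq, pow_eq_zero_iff two_ne_zero, mul_eq_zero, not_or, sub_eq_zero] at hd
    obtain ⟨⟨h01, h02⟩, h12⟩ := hd
    intro i j hij
    fin_cases i <;> fin_cases j <;> simp_all [eq_comm]

theorem exists_isSlopeTriple (S A B : ℂ × ℂ → ℂ) (q : ℂ × ℂ) :
    ∃ p, IsSlopeTriple S A B q p := by
  have ha : (⟨1, S q, A q, B q⟩ : Cubic ℂ).a ≠ 0 := one_ne_zero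
  obtain ⟨x, y, z, h⟩ := (Cubic.splits_iff_roots_eq_three (φ := RingHom.id ℂ) ha).1
    (IsAlgClosed.splits _)
  refine ⟨![x, y, z], isSlopeTriple_iff.2 ⟨?_, ?_, ?_⟩⟩
  · simpa using Cubic.b_eq_three_roots ha h
  · simpa [add_comm, add_left_comm, add_assoc] using Cubic.c_eq_three_roots ha h
  · simpa using Cubic.d_eq_three_roots ha h

theorem isRegularPoint_iff : IsRegularPoint S A B q ↔ cubicDisc S A B q ≠ 0 := by
  constructor
  · rintro ⟨p, hp, hi⟩
    exact hp.injective_iff.1 hi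
  · intro h
    obtain ⟨p, hp⟩ := exists_isSlopeTriple S A B q
    exact ⟨p, hp, hp.injective_iff.2 h⟩

theorem IsSlopeTriple.root (h : IsSlopeTriple S A B q p) (i : Fin 3) :
    p i ^ 3 + S q * p i ^ 2 + A q * p i + B q = 0 := by
  rw [h (p i)]
  exact Finset.prod_eq_zero (Finset.mem_univ i) (sub_self _)

theorem IsSlopeTriple.comp_perm (h : IsSlopeTriple S A B q p) (σ : Equiv.Perm (Fin 3)) :
    IsSlopeTriple S A B q (p ∘ σ) := fun T => by
  rw [h T]
  exact (Equiv.prod_comp σ fun i => T - p i).symm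

/-- The slopes are unique up to the order. -/
theorem IsSlopeTriple.exists_perm (h : IsSlopeTriple S A B q p) {r : Fin 3 → ℂ}
    (h' : IsSlopeTriple S A B q r) : ∃ σ : Equiv.Perm (Fin 3), r ∘ σ = p := by
  -- Once one root is matched, the other two have the same sum and product; matching one root is a
  -- transposition.
  have main : ∀ s : Fin 3 → ℂ, IsSlopeTriple S A B q s → s 0 = p 0 →
      ∃ σ : Equiv.Perm (Fin 3), s ∘ σ = p := by
    intro s hs h0
    obtain ⟨e1, e2, -⟩ := isSlopeTriple_iff.1 h
    obtain ⟨e1', e2', -⟩ := isSlopeTriple_iff.1 hs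
    rw [h0] at e1' e2'
    have hsum : s 1 + s 2 = p 1 + p 2 := by linear_combination e1' - e1
    have hprod : (p 1 - s 1) * (p 1 - s 2) = 0 := by
      linear_combination (-p 1 - p 0) * hsum + e2 - e2'
    rcases mul_eq_zero.1 hprod with h1 | h1
    · refine ⟨1, funext fun i => ?_⟩
      fin_cases i
      · exact h0
      · exact (sub_eq_zero.1 h1).symm
      · change s 2 = p 2
        linear_combination hsum + h1
    · refine ⟨Equiv.swap 1 2, funext fun i => ?_⟩
      fin_cases i
      · exact h0
      · exact (sub_eq_zero.1 h1).symm
      · change s 1 = p 2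
        linear_combination hsum + h1
  have hroot : ∏ i, (p 0 - r i) = 0 := by rw [← h' (p 0)]; exact h.root 0
  obtain ⟨i, -, hi⟩ := Finset.prod_eq_zero_iff.1 hroot
  obtain ⟨σ, hσ⟩ := main (r ∘ Equiv.swap 0 i) (h'.comp_perm _) (by
    rw [Function.comp_apply, Equiv.swap_apply_left]
    exact (sub_eq_zero.1 hi).symm)
  exact ⟨σ.trans (Equiv.swap 0 i), hσ⟩

/-- A root of modulus greater than 1 is bounded by dividing the equation by its square. The bound
keeps the slopes at nearby points in a compact set. -/
theorem IsSlopeTriple.norm_le (h : IsSlopeTriple S A B q p) (i : Fin 3) :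
    ‖p i‖ ≤ 1 + ‖S q‖ + ‖A q‖ + ‖B q‖ := by
  have hr := h.root i
  set z := p i
  by_cases h1 : ‖z‖ ≤ 1
  · have := norm_nonneg (S q); have := norm_nonneg (A q); have := norm_nonneg (B q)
    linarith
  push Not at h1
  have e : z ^ 3 = -(S q * z ^ 2 + A q * z + B q) := by linear_combination hr
  have hn : ‖z‖ ^ 3 ≤ ‖S q‖ * ‖z‖ ^ 2 + ‖A q‖ * ‖z‖ + ‖B q‖ := by
    rw [← norm_pow, e, norm_neg]
    refine (norm_add₃_le).trans ?_
    simp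
  have hA' : ‖A q‖ * ‖z‖ ≤ ‖A q‖ * ‖z‖ ^ 2 := by
    gcongr
    nlinarith
  have hB' : ‖B q‖ ≤ ‖B q‖ * ‖z‖ ^ 2 := by
    exact le_mul_of_one_le_right (norm_nonneg _) (one_le_pow₀ h1.le)
  have : ‖z‖ ^ 2 * ‖z‖ ≤ ‖z‖ ^ 2 * (‖S q‖ + ‖A q‖ + ‖B q‖) := by nlinarith
  have := le_of_mul_le_mul_left this (by positivity)
  linarith

/-- The unordered triple of slopes depends continuously on the point. -/
theorem IsSlopeTriple.eventually_exists (hS : ContinuousAt S q) (hA : ContinuousAt A q)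
    (hB : ContinuousAt B q) (h : IsSlopeTriple S A B q p) {N : Set (Fin 3 → ℂ)} (hN : N ∈ 𝓝 p) :
    ∀ᶠ q' in 𝓝 q, ∃ p' ∈ N, IsSlopeTriple S A B q' p' := by
  -- Take an ultrafilter of bad points converging to `q` and choose slopes arbitrarily over it. By
  -- compactness they converge along the ultrafilter; the limit is a slope triple at `q`, hence a
  -- reordering of `p`, and the same reordering of the chosen slopes enters `N`.
  by_contra hcon
  obtain ⟨U, hUb⟩ := Filter.exists_ultrafilter_iff.2
    (Filter.frequently_iff_neBot.1 (Filter.not_eventually.1 hcon))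
  have hU : (U : Filter (ℂ × ℂ)) ≤ 𝓝 q := hUb.trans inf_le_left
  have hbad : ∀ᶠ q' in (U : Filter (ℂ × ℂ)), ¬∃ p' ∈ N, IsSlopeTriple S A B q' p' :=
    hUb.trans inf_le_right (mem_principal_self _)
  choose r hr using exists_isSlopeTriple S A B
  have hSU : Tendsto S U (𝓝 (S q)) := hS.tendsto.mono_left hU
  have hAU : Tendsto A U (𝓝 (A q)) := hA.tendsto.mono_left hU
  have hBU : Tendsto B U (𝓝 (B q)) := hB.tendsto.mono_left hU
  set M := 1 + ‖S q‖ + ‖A q‖ + ‖B q‖ + 1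
  have hM : ∀ᶠ q' in (U : Filter (ℂ × ℂ)), r q' ∈ Metric.closedBall (0 : Fin 3 → ℂ) M := by
    have hlim : Tendsto (fun q' => 1 + ‖S q'‖ + ‖A q'‖ + ‖B q'‖) U
        (𝓝 (1 + ‖S q‖ + ‖A q‖ + ‖B q‖)) :=
      ((tendsto_const_nhds.add hSU.norm).add hAU.norm).add hBU.norm
    filter_upwards [hlim.eventually (gt_mem_nhds (lt_add_one _))] with q' hq'
    rw [mem_closedBall_zero_iff, pi_norm_le_iff_of_nonneg (by positivity)]
    exact fun i => ((hr q').norm_le i).trans hq'.le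
  obtain ⟨s, -, hs⟩ := (isCompact_closedBall (0 : Fin 3 → ℂ) M).ultrafilter_le_nhds (Ultrafilter.map r U)
    (le_principal_iff.2 hM)
  have hrs : Tendsto r U (𝓝 s) := hs
  have hsq : IsSlopeTriple S A B q s := fun T => by
    have h1 : Tendsto (fun q' => T ^ 3 + S q' * T ^ 2 + A q' * T + B q') U
        (𝓝 (T ^ 3 + S q * T ^ 2 + A q * T + B q)) :=
      (((hSU.mul_const _).const_add _).add (hAU.mul_const _)).add hBU
    have h2 : Tendsto (fun q' => ∏ i, (T - r q' i)) U (𝓝 (∏ i, (T - s i))) :=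
      tendsto_finsetProd _ fun i _ => (tendsto_pi_nhds.1 hrs i).const_sub T
    exact tendsto_nhds_unique h1 (h2.congr fun q' => (hr q' T).symm)
  obtain ⟨σ, hσ⟩ := h.exists_perm hsq
  have hrσ : Tendsto (fun q' => r q' ∘ σ) U (𝓝 p) := by
    rw [← hσ]
    exact tendsto_pi_nhds.2 fun i => tendsto_pi_nhds.1 hrs (σ i)
  obtain ⟨q', hq', hq''⟩ := (hbad.and (hrσ hN)).exists
  exact hq' ⟨_, hq'', (hr q').comp_perm σ⟩

end Slopes

/-! ### Idempotents of the tangent algebras -/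

theorem nullMul_comm (a b c d : ℂ) (u v : ℂ × ℂ × ℂ) : nullMul a b c d u v = nullMul a b c d v u := by
  simp only [nullMul_apply, Prod.mk.injEq]
  refine ⟨?_, ?_, ?_⟩ <;> ring

/-- The multiplication determined by the coefficients of the cubic and a normalizing factor `k`. -/
noncomputable def cubicMul (S A B k : ℂ) : ℂ × ℂ × ℂ →L[ℂ] ℂ × ℂ × ℂ →L[ℂ] ℂ × ℂ × ℂ :=
  nullMul (-(B * k)) (-(A * k)) (S * k) k

/-- The eigenvector of the multiplication attached to a slope `p`. -/
def slopeVector (S k p : ℂ) : ℂ × ℂ × ℂ := (1, k * (p + S), k * p * (p + S))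

/-- The `t`-component of any product is the inner product of the factors, and the vector has
`t`-component 1, so the eigenvalue can only be this one. The other components reduce to the cubic
equation and the normalization of `k`. -/
theorem cubicMul_slopeVector {S A B k p : ℂ} (hk : k ^ 2 * (S * A - B) = 1)
    (hp : p ^ 3 + S * p ^ 2 + A * p + B = 0) (w : ℂ × ℂ × ℂ) :
    cubicMul S A B k (slopeVector S k p) w =
      nullMetric (slopeVector S k p) w • slopeVector S k p := by
  simp only [cubicMul, nullMul_apply, nullMetric_apply, slopeVector, Prod.smul_mk, smul_eq_mul,
    Prod.mk.injEq]
  refine ⟨?_, ?_, ?_⟩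
  · ring
  · linear_combination -w.2.1 * hk - w.2.1 * k ^ 2 * hp
  · linear_combination -w.2.2 * hk - (w.2.2 + w.2.1 * (p + S)) * k ^ 2 * hp

section Triples

variable {S A B : ℂ × ℂ → ℂ} {q : ℂ × ℂ} {k : ℂ} {p : Fin 3 → ℂ}

/-- At `T = -S` the cubic takes the value `B - S A ≠ 0`, so `-S` is not a root. Hence a slope vector
is never a multiple of `∂t`. -/
theorem slope_add_ne_zero {S A B k p : ℂ} (hk : k ^ 2 * (S * A - B) = 1)
    (hp : p ^ 3 + S * p ^ 2 + A * p + B = 0) : k * (p + S) ≠ 0 := by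
  intro h
  rcases mul_eq_zero.1 h with h | h
  · simp [h] at hk
  · have : (1 : ℂ) = 0 := by linear_combination -hk - k ^ 2 * hp + k ^ 2 * (p ^ 2 + A) * h
    exact one_ne_zero this

/-- The norm is `1 + 2 k² p (p + S)²`. It factors once 1 is replaced by `k² (S A - B)`, which in
terms of the roots is `-k² (p 0 + p 1) (p 1 + p 2) (p 0 + p 2)`. -/
theorem nullMetric_slopeVector_self (hk : k ^ 2 * (S q * A q - B q) = 1)
    (h : IsSlopeTriple S A B q p) :
    nullMetric (slopeVector (S q) k (p 0)) (slopeVector (S q) k (p 0)) =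
        -k ^ 2 * ((p 1 + p 2) * (p 0 - p 1) * (p 0 - p 2)) ∧
    nullMetric (slopeVector (S q) k (p 1)) (slopeVector (S q) k (p 1)) =
        -k ^ 2 * ((p 0 + p 2) * (p 1 - p 0) * (p 1 - p 2)) ∧
    nullMetric (slopeVector (S q) k (p 2)) (slopeVector (S q) k (p 2)) =
        -k ^ 2 * ((p 0 + p 1) * (p 2 - p 0) * (p 2 - p 1)) := by
  obtain ⟨hS, hA, hB⟩ := isSlopeTriple_iff.1 h
  rw [hS, hA, hB] at hk
  rw [hS]
  simp only [nullMetric_apply, slopeVector]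
  refine ⟨?_, ?_, ?_⟩ <;> linear_combination -hk

theorem nullMetric_slopeVector_self_ne_zero (hk : k ^ 2 * (S q * A q - B q) = 1)
    (h : IsSlopeTriple S A B q p) (hp : Function.Injective p) (i : Fin 3) :
    nullMetric (slopeVector (S q) k (p i)) (slopeVector (S q) k (p i)) ≠ 0 := by
  obtain ⟨h0, h1, h2⟩ := nullMetric_slopeVector_self hk h
  have e : ∀ i j : Fin 3, i ≠ j → p i - p j ≠ 0 := fun i j hij => sub_ne_zero.2 (hp.ne hij)
  have hs : ∀ i, p i + S q ≠ 0 := fun i => right_ne_zero_of_mul (slope_add_ne_zero hk (h.root i))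
  obtain ⟨hS, -, -⟩ := isSlopeTriple_iff.1 h
  have hk0 : -k ^ 2 ≠ 0 := neg_ne_zero.2 (left_ne_zero_of_mul (hk ▸ one_ne_zero))
  have s0 : p 1 + p 2 ≠ 0 := fun e => hs 0 (by linear_combination hS - e)
  have s1 : p 0 + p 2 ≠ 0 := fun e => hs 1 (by linear_combination hS - e)
  have s2 : p 0 + p 1 ≠ 0 := fun e => hs 2 (by linear_combination hS - e)
  fin_cases i
  · exact h0 ▸ mul_ne_zero hk0 (mul_ne_zero (mul_ne_zero s0 (e 0 1 (by decide))) (e 0 2 (by decide)))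
  · exact h1 ▸ mul_ne_zero hk0 (mul_ne_zero (mul_ne_zero s1 (e 1 0 (by decide))) (e 1 2 (by decide)))
  · exact h2 ▸ mul_ne_zero hk0 (mul_ne_zero (mul_ne_zero s2 (e 2 0 (by decide))) (e 2 1 (by decide)))

/-- The product of the two vectors is their inner product times either of them, and their
`x`-components differ by `k (p i - p j) ≠ 0`. -/
theorem nullMetric_slopeVector_of_ne (hk : k ^ 2 * (S q * A q - B q) = 1)
    (h : IsSlopeTriple S A B q p) {i j : Fin 3} (hij : p i ≠ p j) :
    nullMetric (slopeVector (S q) k (p i)) (slopeVector (S q) k (p j)) = 0 := by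
  have e := cubicMul_slopeVector hk (h.root i) (slopeVector (S q) k (p j))
  have e' := cubicMul_slopeVector hk (h.root j) (slopeVector (S q) k (p i))
  rw [cubicMul, nullMul_comm, ← cubicMul, e'] at e
  have e1 := congrArg (fun v => v.1) e
  have e2 := congrArg (fun v => v.2.1) e
  simp only [slopeVector, Prod.smul_mk, smul_eq_mul, mul_one] at e1 e2
  simp only [slopeVector]
  rw [e1] at e2
  have hk0 : k ≠ 0 := by
    rintro rfl
    simp at hk
  have : k * (p i - p j) ≠ 0 := mul_ne_zero hk0 (sub_ne_zero.2 hij)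
  apply (mul_eq_zero.1 _).resolve_right this
  linear_combination -e2

/-- At a point with distinct slopes the tangent algebra has a basis of orthogonal idempotents,
proportional to the vectors attached to the slopes. -/
theorem exists_idempotent_basis (hk : k ^ 2 * (S q * A q - B q) = 1)
    (h : IsSlopeTriple S A B q p) (hp : Function.Injective p) :
    ∃ b : Module.Basis (Fin 3) ℂ (ℂ × ℂ × ℂ),
      (∀ i j, cubicMul (S q) (A q) (B q) k (b i) (b j) = if i = j then b i else 0) ∧
      ∀ i, ∃ n : ℂ, slopeVector (S q) k (p i) = n • b i := by
  set v : Fin 3 → ℂ × ℂ × ℂ := fun i => slopeVector (S q) k (p i)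
  set n : Fin 3 → ℂ := fun i => nullMetric (v i) (v i)
  have hn : ∀ i, n i ≠ 0 := nullMetric_slopeVector_self_ne_zero hk h hp
  set e : Fin 3 → ℂ × ℂ × ℂ := fun i => (n i)⁻¹ • v i
  -- Pairing with `v i` is the coordinate functional dual to `e`; this gives both linear
  -- independence and the multiplication table.
  have he : ∀ i j, nullMetric (v i) (e j) = if i = j then 1 else 0 := by
    intro i j
    simp only [e, map_smul, smul_eq_mul]
    split_ifs with hij
    · subst hij
      exact inv_mul_cancel₀ (hn i)
    · rw [nullMetric_slopeVector_of_ne hk h (hp.ne hij), mul_zero]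
  have hli : LinearIndependent ℂ e := by
    rw [Fintype.linearIndependent_iff]
    intro g hg i
    have := congrArg (nullMetric (v i)) hg
    simpa [he] using this
  have hcard : Fintype.card (Fin 3) = Module.finrank ℂ (ℂ × ℂ × ℂ) := by simp
  refine ⟨basisOfLinearIndependentOfCardEqFinrank hli hcard, fun i j => ?_, fun i => ⟨n i, ?_⟩⟩
  · simp only [coe_basisOfLinearIndependentOfCardEqFinrank]
    have h1 : cubicMul (S q) (A q) (B q) k (e i) (e j) = (n i)⁻¹ • nullMetric (v i) (e j) • v i := by
      rw [← cubicMul_slopeVector hk (h.root i)]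
      simp only [e, map_smul, smul_apply]
      exact smul_comm _ _ _
    rw [h1, he]
    split_ifs <;> simp [e]
  · simp only [coe_basisOfLinearIndependentOfCardEqFinrank, e]
    rw [smul_inv_smul₀ (hn i)]

end Triples

namespace FrobeniusStructure

variable {V : Type*} [NormedAddCommGroup V] [NormedSpace ℂ V] {F : FrobeniusStructure V} {p : V}

theorem IsIdempotentBasis.mul_basis {b : Module.Basis (Fin 3) ℂ V} (hb : F.IsIdempotentBasis p b)
    (v : V) (i : Fin 3) : F.mul p v (b i) = b.repr v i • b i := by
  conv_lhs => rw [← b.sum_repr v]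
  rw [map_sum, sum_apply]
  simp [hb _ i]

/-- A semi-simple algebra has no nilpotent elements. -/
theorem IsSemisimpleAt.eq_zero_of_mul_self (h : F.IsSemisimpleAt p) (hp : p ∈ F.carrier) {v : V}
    (hv : F.mul p v v = 0) : v = 0 := by
  obtain ⟨b, hb⟩ := h
  refine b.ext_elem fun i => ?_
  have e := F.mul_assoc p hp v v (b i)
  rw [hv, hb.mul_basis v, map_smul, hb.mul_basis v, smul_smul, map_zero,
    zero_apply] at e
  simpa [b.ne_zero i] using e.symm

end FrobeniusStructure

/-! ### The coefficients along the infinitesimal symmetry -/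

theorem fderiv_diagFlow_apply (wx wy τ : ℂ) (q v : ℂ × ℂ) :
    fderiv ℂ (diagFlow wx wy τ) q v = diagFlow wx wy τ v := by
  have h : HasFDerivAt (diagFlow wx wy τ) _ q :=
    ((hasFDerivAt_fst (𝕜 := ℂ) (p := q)).const_mul (Complex.exp (wx * τ))).prodMk
      ((hasFDerivAt_snd (𝕜 := ℂ) (p := q)).const_mul (Complex.exp (wy * τ)))
  rw [h.fderiv]
  simp [diagFlow]

section Symmetry

variable {S A B : ℂ × ℂ → ℂ} {wx wy : ℂ} {q : ℂ × ℂ}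

/-- A diagonal linear map preserving the web directions rescales the slopes. -/
theorem IsSlopeTriple.diagFlow {p : Fin 3 → ℂ} (h : IsSlopeTriple S A B q p)
    (hp : Function.Injective p) {τ : ℂ}
    (hsymm : ∀ v, IsSolutionDirection S A B q v ↔
      IsSolutionDirection S A B (diagFlow wx wy τ q) (fderiv ℂ (diagFlow wx wy τ) q v)) :
    IsSlopeTriple S A B (diagFlow wx wy τ q) (fun i => Complex.exp ((wy - wx) * τ) * p i) := by
  refine isSlopeTriple_of_injective
    (fun i j hij => hp (mul_left_cancel₀ (Complex.exp_ne_zero _) hij)) fun i => ?_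
  have h1 : IsSolutionDirection S A B q (1, p i) := by
    refine ⟨fun h0 => one_ne_zero (congrArg Prod.fst h0), ?_⟩
    simpa using h.root i
  have h2 := ((hsymm _).1 h1).2
  rw [fderiv_diagFlow_apply] at h2
  have he : Complex.exp (wy * τ) = Complex.exp ((wy - wx) * τ) * Complex.exp (wx * τ) := by
    rw [← Complex.exp_add]
    ring_nf
  simp only [_root_.diagFlow, he] at h2 ⊢
  apply mul_left_cancel₀ (pow_ne_zero 3 (Complex.exp_ne_zero (wx * τ)))
  linear_combination h2

/-- Quasi-homogeneity of the coefficients at a regular point, from the infinitesimal symmetry. -/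
theorem fderiv_diagField_of_isRegularPoint (hS : DifferentiableAt ℂ S q)
    (hA : DifferentiableAt ℂ A q) (hB : DifferentiableAt ℂ B q) (hreg : IsRegularPoint S A B q)
    (hsymm : ∀ᶠ τ in 𝓝 (0 : ℂ), ∀ v, IsSolutionDirection S A B q v ↔
      IsSolutionDirection S A B (diagFlow wx wy τ q) (fderiv ℂ (diagFlow wx wy τ) q v)) :
    fderiv ℂ S q (diagField wx wy q) = (wy - wx) * S q ∧
    fderiv ℂ A q (diagField wx wy q) = 2 * (wy - wx) * A q ∧
    fderiv ℂ B q (diagField wx wy q) = 3 * (wy - wx) * B q := by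
  obtain ⟨p, hp, hinj⟩ := hreg
  obtain ⟨hSq, hAq, hBq⟩ := isSlopeTriple_iff.1 hp
  have hflow : ∀ᶠ τ in 𝓝 (0 : ℂ), IsSlopeTriple S A B (diagFlow wx wy τ q)
      (fun i => Complex.exp ((wy - wx) * τ) * p i) :=
    hsymm.mono fun τ hτ => hp.diagFlow hinj hτ
  -- `m` is the degree in the slopes: 1, 2, 3 for `S, A, B`. Scaling along the flow is
  -- differentiated at `τ = 0`.
  have key : ∀ (f : ℂ × ℂ → ℂ) (m : ℕ), DifferentiableAt ℂ f q →
      (∀ᶠ τ in 𝓝 (0 : ℂ), f (diagFlow wx wy τ q) = Complex.exp ((wy - wx) * τ) ^ m * f q) →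
      fderiv ℂ f q (diagField wx wy q) = m * (wy - wx) * f q := by
    intro f m hf hev
    have h0 := hasDerivAt_diagFlow wx wy 0 q
    rw [diagFlow_zero] at h0
    have hf' : HasFDerivAt f (fderiv ℂ f q) (diagFlow wx wy 0 q) := by
      rw [diagFlow_zero]
      exact hf.hasFDerivAt
    have h1 := hf'.comp_hasDerivAt 0 h0
    have h2 : HasDerivAt (fun τ : ℂ => (wy - wx) * τ) (wy - wx) 0 := by
      simpa using (hasDerivAt_id (0 : ℂ)).const_mul (wy - wx)
    have h3 := ((h2.cexp.pow m).mul_const (f q)).congr_of_eventuallyEq hev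
    rw [h1.unique h3]
    simp
  refine ⟨?_, ?_, ?_⟩
  · rw [key S 1 hS]
    · simp
    · filter_upwards [hflow] with τ hτ
      rw [(isSlopeTriple_iff.1 hτ).1, hSq]
      ring
  · rw [key A 2 hA]
    · simp
    · filter_upwards [hflow] with τ hτ
      rw [(isSlopeTriple_iff.1 hτ).2.1, hAq]
      ring
  · rw [key B 3 hB]
    · simp
    · filter_upwards [hflow] with τ hτ
      rw [(isSlopeTriple_iff.1 hτ).2.2, hBq]
      ring

end Symmetry

/-! ### Passage from regular points to all points, and the normalizing factor -/

theorem eq_of_frequently_eq {X : Type*} [TopologicalSpace X] {f g : X → ℂ} {x : X}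
    (hf : ContinuousAt f x) (hg : ContinuousAt g x) (h : ∃ᶠ y in 𝓝 x, f y = g y) : f x = g x := by
  by_contra hne
  exact h ((hf.sub hg).eventually_ne (sub_ne_zero.2 hne) |>.mono fun y hy => sub_ne_zero.1 hy)

/-- An analytic function that is not identically zero near one point of a ball is not
identically zero near any of its points. -/
theorem frequently_ne_zero_of_mem_ball {f : ℂ × ℂ → ℂ} {q₀ q : ℂ × ℂ} {r : ℝ}
    (hf : AnalyticOnNhd ℂ f (Metric.ball q₀ r)) (h₀ : ∃ᶠ q' in 𝓝 q₀, f q' ≠ 0)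
    (hq : q ∈ Metric.ball q₀ r) : ∃ᶠ q' in 𝓝 q, f q' ≠ 0 := by
  intro h
  have hr : 0 < r := dist_nonneg.trans_lt hq
  have h0 : f =ᶠ[𝓝 q] 0 := h.mono fun q' hq' => not_not.1 hq'
  have := hf.eqOn_zero_of_preconnected_of_eventuallyEq_zero
    (convex_ball q₀ r).isPreconnected hq h0
  refine h₀ ?_
  filter_upwards [Metric.ball_mem_nhds q₀ hr] with q' hq'
  exact not_not.2 (this hq')

theorem exists_analyticAt_sq_mul_eq_one {D : ℂ × ℂ → ℂ} {q₀ : ℂ × ℂ} (hD : AnalyticAt ℂ D q₀)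
    (h0 : D q₀ ≠ 0) : ∃ k : ℂ × ℂ → ℂ, AnalyticAt ℂ k q₀ ∧ ∀ᶠ q in 𝓝 q₀, k q ^ 2 * D q = 1 := by
  -- Dividing by `D q₀` brings the value at `q₀` to 1, where the principal logarithm is analytic;
  -- `c` restores the constant.
  obtain ⟨c, hc⟩ := IsAlgClosed.exists_pow_nat_eq (D q₀)⁻¹ (n := 2) two_pos
  have hq : AnalyticAt ℂ (fun q => D q / D q₀) q₀ := hD.div_const
  have hlog : AnalyticAt ℂ (fun q => Complex.log (D q / D q₀)) q₀ :=
    hq.clog (by simp [h0])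
  refine ⟨fun q => c * Complex.exp (-(1 / 2) * Complex.log (D q / D q₀)),
    analyticAt_const.mul (analyticAt_const.mul hlog).cexp, ?_⟩
  filter_upwards [hD.continuousAt.eventually_ne h0] with q hq0
  have e : Complex.exp (-(1 / 2) * Complex.log (D q / D q₀)) ^ 2 = (D q / D q₀)⁻¹ := by
    rw [← Complex.exp_nat_mul]
    have : ((2 : ℕ) : ℂ) * (-(1 / 2) * Complex.log (D q / D q₀)) = -Complex.log (D q / D q₀) := by
      push_cast
      ring
    rw [this, Complex.exp_neg, Complex.exp_log (div_ne_zero hq0 h0)]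
  rw [mul_pow, e, hc]
  field_simp

/-! ### Closedness and homogeneity of the third derivatives -/

section Potential

variable {S A B k : ℂ × ℂ → ℂ} {q : ℂ × ℂ}

/-- This is the logarithmic derivative of `k² (S A - B) = 1`, with denominators cleared; it
eliminates the derivatives of `k` from the closedness relations. -/
theorem two_mul_disc_mul_fderiv (hS : DifferentiableAt ℂ S q) (hA : DifferentiableAt ℂ A q)
    (hB : DifferentiableAt ℂ B q) (hk : DifferentiableAt ℂ k q)
    (h : ∀ᶠ q' in 𝓝 q, k q' ^ 2 * (S q' * A q' - B q') = 1) (z : ℂ × ℂ) :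
    fderiv ℂ k q z * (2 * (S q * A q - B q)) =
      -k q * (A q * fderiv ℂ S q z + S q * fderiv ℂ A q z - fderiv ℂ B q z) := by
  have h1 := (hk.hasFDerivAt.pow 2).mul ((hS.hasFDerivAt.mul hA.hasFDerivAt).sub hB.hasFDerivAt)
  have h2 := h1.congr_of_eventuallyEq (f₁ := fun _ => (1 : ℂ)) (h.mono fun _ hq => hq.symm)
  have h3 := congrArg (fun L : ℂ × ℂ →L[ℂ] ℂ => L z) (h2.unique (hasFDerivAt_const (1 : ℂ) q))
  have hk0 : k q ≠ 0 := by
    intro e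
    simpa [e] using h.self_of_nhds
  simp at h3
  apply mul_left_cancel₀ hk0
  linear_combination h3

theorem fderiv_mul_apply_eq {f g : ℂ × ℂ → ℂ} (hf : DifferentiableAt ℂ f q)
    (hg : DifferentiableAt ℂ g q) (z : ℂ × ℂ) :
    fderiv ℂ (fun r => f r * g r) q z = fderiv ℂ f q z * g q + f q * fderiv ℂ g q z := by
  rw [fderiv_fun_mul hf hg]
  simp
  ring

theorem fderiv_neg_mul_apply_eq {f g : ℂ × ℂ → ℂ} (hf : DifferentiableAt ℂ f q)
    (hg : DifferentiableAt ℂ g q) (z : ℂ × ℂ) :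
    fderiv ℂ (fun r => -(f r * g r)) q z = -(fderiv ℂ f q z * g q + f q * fderiv ℂ g q z) := by
  rw [fderiv_fun_neg, ← fderiv_mul_apply_eq hf hg]
  rfl

end Potential

/-- The third derivatives of the potential attached to the coefficients of the cubic. -/
noncomputable def PotentialData.ofCubic {S A B k : ℂ × ℂ → ℂ} {wx wy : ℂ} {U : Set (ℂ × ℂ)}
    (hU : IsOpen U) (hS : AnalyticOnNhd ℂ S U) (hA : AnalyticOnNhd ℂ A U)
    (hB : AnalyticOnNhd ℂ B U) (hk : AnalyticOnNhd ℂ k U)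
    (hkD : ∀ q ∈ U, k q ^ 2 * (S q * A q - B q) = 1)
    (hsys : ∀ q ∈ U, SatisfiesHydrodynamicSystem S A B q)
    (hom : ∀ q ∈ U, fderiv ℂ S q (diagField wx wy q) = (wy - wx) * S q ∧
      fderiv ℂ A q (diagField wx wy q) = 2 * (wy - wx) * A q ∧
      fderiv ℂ B q (diagField wx wy q) = 3 * (wy - wx) * B q) : PotentialData wx wy :=
  have hdk : ∀ q ∈ U, ∀ z, fderiv ℂ k q z * (2 * (S q * A q - B q)) =
      -k q * (A q * fderiv ℂ S q z + S q * fderiv ℂ A q z - fderiv ℂ B q z) := fun q hq z =>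
    two_mul_disc_mul_fderiv (hS q hq).differentiableAt (hA q hq).differentiableAt
      (hB q hq).differentiableAt (hk q hq).differentiableAt
      (eventually_of_mem (hU.mem_nhds hq) hkD) z
  have hD : ∀ q ∈ U, 2 * (S q * A q - B q) ≠ 0 := fun q hq =>
    mul_ne_zero two_ne_zero (right_ne_zero_of_mul (hkD q hq ▸ one_ne_zero))
  have hsys' : ∀ q ∈ U, partialX S q * (2 * (S q * A q - B q)) =
        (A q ^ 2 - A q * S q ^ 2 + 2 * S q * B q) * partialY S q
          + (S q ^ 3 - A q * S q + 2 * B q) * partialY A q - (A q + S q ^ 2) * partialY B q ∧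
      partialX A q = (-(A q) * partialY S q + S q * partialY A q + partialY B q) / 2 ∧
      partialX B q * (2 * (S q * A q - B q)) =
        (A q ^ 3 + 4 * B q ^ 2 - 3 * A q * S q * B q) * partialY S q
          + (2 * A q * B q - S q * A q ^ 2 + B q * S q ^ 2) * partialY A q
          + (2 * A q * S q ^ 2 - 3 * S q * B q - A q ^ 2) * partialY B q := fun q hq => by
    obtain ⟨h1, h2, h3⟩ := hsys q hq
    have e : 2 * A q * S q - 2 * B q = 2 * (S q * A q - B q) := by ring
    rw [e] at h1 h3
    exact ⟨(eq_div_iff (hD q hq)).1 h1, h2, (eq_div_iff (hD q hq)).1 h3⟩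
  -- `S A - B` has weight 3 and `k` is an inverse square root of it, hence the weight `-3/2`.
  have homk : ∀ q ∈ U, fderiv ℂ k q (diagField wx wy q) = -3 / 2 * (wy - wx) * k q :=
    fun q hq => by
      obtain ⟨h1, h2, h3⟩ := hom q hq
      have h := hdk q hq (diagField wx wy q)
      rw [h1, h2, h3] at h
      apply mul_right_cancel₀ (hD q hq)
      linear_combination h
  { U := U
    isOpen_U := hU
    a := fun q => -(B q * k q)
    b := fun q => -(A q * k q)
    c := fun q => S q * k q
    d := k
    analytic_a := (hB.mul hk).neg
    analytic_b := (hA.mul hk).neg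
    analytic_c := hS.mul hk
    analytic_d := hk
    closed_ab := fun q hq => by
      obtain ⟨hSx, hAx, hBx⟩ := hsys' q hq
      have hkx := hdk q hq (1, 0)
      have hky := hdk q hq (0, 1)
      simp only [partialX, partialY] at *
      rw [fderiv_neg_mul_apply_eq (hB q hq).differentiableAt (hk q hq).differentiableAt,
        fderiv_neg_mul_apply_eq (hA q hq).differentiableAt (hk q hq).differentiableAt]
      -- Two factors `2 (S A - B)` are needed: one for the derivatives of `k`, and a second for
      -- `S_x` and `B_x`, which occur inside `k_x`.
      apply mul_right_cancel₀ (hD q hq)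
      apply mul_right_cancel₀ (hD q hq)
      set D := S q * A q - B q with hDdef
      linear_combination -(2 * D * B q) * hky + 4 * D ^ 2 * k q * hAx + 2 * D * A q * hkx
        - (A q * k q * A q * hSx + 2 * D * A q * k q * S q * hAx - A q * k q * hBx)
    closed_bc := fun q hq => by
      obtain ⟨hSx, hAx, hBx⟩ := hsys' q hq
      have hkx := hdk q hq (1, 0)
      have hky := hdk q hq (0, 1)
      simp only [partialX, partialY] at *
      rw [fderiv_mul_apply_eq (hS q hq).differentiableAt (hk q hq).differentiableAt,
        fderiv_neg_mul_apply_eq (hA q hq).differentiableAt (hk q hq).differentiableAt]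
      apply mul_right_cancel₀ (hD q hq)
      apply mul_right_cancel₀ (hD q hq)
      set D := S q * A q - B q with hDdef
      linear_combination -(2 * D * A q) * hky - 2 * D * k q * hSx - 2 * D * S q * hkx
        + (S q * k q * A q * hSx + 2 * D * S q * k q * S q * hAx - S q * k q * hBx)
    closed_cd := fun q hq => by
      obtain ⟨hSx, hAx, hBx⟩ := hsys' q hq
      have hkx := hdk q hq (1, 0)
      have hky := hdk q hq (0, 1)
      simp only [partialX, partialY] at *
      rw [fderiv_mul_apply_eq (hS q hq).differentiableAt (hk q hq).differentiableAt]
      apply mul_right_cancel₀ (hD q hq)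
      apply mul_right_cancel₀ (hD q hq)
      set D := S q * A q - B q with hDdef
      linear_combination (2 * D * S q) * hky - 2 * D * hkx
        + (k q * A q * hSx + 2 * D * k q * S q * hAx - k q * hBx)
    assoc := fun q hq => by linear_combination hkD q hq
    hom_a := fun q hq => by
      rw [fderiv_neg_mul_apply_eq (hB q hq).differentiableAt (hk q hq).differentiableAt,
        homk q hq, (hom q hq).2.2]
      ring
    hom_b := fun q hq => by
      rw [fderiv_neg_mul_apply_eq (hA q hq).differentiableAt (hk q hq).differentiableAt,
        homk q hq, (hom q hq).2.1]
      ring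
    hom_c := fun q hq => by
      rw [fderiv_mul_apply_eq (hS q hq).differentiableAt (hk q hq).differentiableAt,
        homk q hq, (hom q hq).1]
      ring
    hom_d := homk }

/-! ### The booklet web -/

namespace PotentialData

variable {wx wy : ℂ} (P : PotentialData wx wy)

/-- The surface `t = 0`. -/
noncomputable def surface : P.frobenius.TransverseSurface where
  U := P.U
  isOpen_U := P.isOpen_U
  ι := ContinuousLinearMap.inr ℂ ℂ (ℂ × ℂ)
  analytic_ι := ContinuousLinearMap.analyticOnNhd _ _
  mapsTo_ι _ hq := hq
  injOn_ι := (LinearMap.inr_injective (R := ℂ)).injOn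
  immersion q _ := by
    rw [ContinuousLinearMap.fderiv]
    exact LinearMap.inr_injective (R := ℂ)
  transverse q _ := by
    rw [ContinuousLinearMap.fderiv]
    rintro ⟨v, hv⟩
    exact zero_ne_one (congrArg Prod.fst hv)

/-- On the surface `t = 0` the Euler field projects to `wx x ∂x + wy y ∂y` along the unity. -/
theorem euler_sub_mem (q : ℂ × ℂ) :
    P.frobenius.euler (P.surface.ι q) - fderiv ℂ P.surface.ι q (diagField wx wy q) ∈
      Submodule.span ℂ ({P.frobenius.unity (P.surface.ι q)} : Set (ℂ × ℂ × ℂ)) := by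
  have h : P.frobenius.euler (P.surface.ι q) - fderiv ℂ P.surface.ι q (diagField wx wy q) = 0 := by
    change linearEuler ((wx + wy) / 2) wx wy (ContinuousLinearMap.inr ℂ ℂ (ℂ × ℂ) q)
      - fderiv ℂ (ContinuousLinearMap.inr ℂ ℂ (ℂ × ℂ)) q (diagField wx wy q) = 0
    rw [ContinuousLinearMap.fderiv, linearEuler_apply]
    ext <;> simp [diagField]
  rw [h]
  exact zero_mem _

section Web

variable {P} {S A B k : ℂ × ℂ → ℂ}

theorem isSemisimpleAt_of_cubicDisc_ne_zero
    (hmul : ∀ p, P.frobenius.mul p = cubicMul (S p.2) (A p.2) (B p.2) (k p.2))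
    (hkD : ∀ q ∈ P.U, k q ^ 2 * (S q * A q - B q) = 1) {p : ℂ × ℂ × ℂ} (hp : p.2 ∈ P.U)
    (h : cubicDisc S A B p.2 ≠ 0) : P.frobenius.IsSemisimpleAt p := by
  obtain ⟨r, hr⟩ := exists_isSlopeTriple S A B p.2
  obtain ⟨b, hb, -⟩ := exists_idempotent_basis (hkD _ hp) hr (hr.injective_iff.2 h)
  exact ⟨b, fun i j => by rw [hmul]; exact hb i j⟩

/-- The slope vector of a multiple root has norm zero, hence square zero. It is nonzero, its
`t`-component being 1, and a semi-simple algebra has no such element. -/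
theorem cubicDisc_ne_zero_of_isSemisimpleAt
    (hmul : ∀ p, P.frobenius.mul p = cubicMul (S p.2) (A p.2) (B p.2) (k p.2))
    (hkD : ∀ q ∈ P.U, k q ^ 2 * (S q * A q - B q) = 1) {p : ℂ × ℂ × ℂ} (hp : p.2 ∈ P.U)
    (h : P.frobenius.IsSemisimpleAt p) : cubicDisc S A B p.2 ≠ 0 := by
  obtain ⟨r, hr⟩ := exists_isSlopeTriple S A B p.2
  have hne : ∀ i, nullMetric (slopeVector (S p.2) (k p.2) (r i))
      (slopeVector (S p.2) (k p.2) (r i)) ≠ 0 := by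
    intro i h0
    have e := h.eq_zero_of_mul_self hp (v := slopeVector (S p.2) (k p.2) (r i)) (by
      rw [hmul, cubicMul_slopeVector (hkD _ hp) (hr.root i), h0, zero_smul])
    exact one_ne_zero (congrArg Prod.fst e)
  obtain ⟨h0, h1, -⟩ := nullMetric_slopeVector_self (hkD _ hp) hr
  have hne0 := h0 ▸ hne 0
  have hne1 := h1 ▸ hne 1
  simp only [neg_mul, ne_eq, neg_eq_zero, mul_eq_zero, not_or] at hne0 hne1
  rw [hr.cubicDisc_eq]
  exact pow_ne_zero 2 (mul_ne_zero (mul_ne_zero hne0.2.1.2 hne0.2.2) hne1.2.2)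

theorem isRegularBookletTriple_of_isSlopeTriple
    (hmul : ∀ p, P.frobenius.mul p = cubicMul (S p.2) (A p.2) (B p.2) (k p.2))
    (hkD : ∀ q ∈ P.U, k q ^ 2 * (S q * A q - B q) = 1) {q : ℂ × ℂ} (hq : q ∈ P.U)
    {p : Fin 3 → ℂ} (hp : IsSlopeTriple S A B q p)
    (h : P.frobenius.IsSemisimpleAt (P.surface.ι q)) :
    P.surface.IsRegularBookletTriple q fun i => (1, p i) := by
  have hinj : Function.Injective p := hp.injective_iff.2
    (cubicDisc_ne_zero_of_isSemisimpleAt hmul hkD (p := P.surface.ι q) hq h)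
  obtain ⟨b, hb, hv⟩ := exists_idempotent_basis (hkD q hq) hp hinj
  refine ⟨b, fun i j => by rw [hmul]; exact hb i j, fun i => ⟨?_, ?_⟩⟩
  · exact fun h0 => one_ne_zero (congrArg Prod.fst h0)
  · obtain ⟨n, hn⟩ := hv i
    change fderiv ℂ (ContinuousLinearMap.inr ℂ ℂ (ℂ × ℂ)) q (1, p i) ∈
      Submodule.span ℂ ({(1, 0, 0), b i} : Set (ℂ × ℂ × ℂ))
    have hm : k q * (p i + S q) ≠ 0 := slope_add_ne_zero (hkD q hq) (hp.root i)
    rw [ContinuousLinearMap.fderiv, Submodule.mem_span_pair]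
    -- The slope vector equals `∂t + k (p + S) (∂x + p ∂y)`; solve for `∂x + p ∂y`.
    refine ⟨-(k q * (p i + S q))⁻¹, (k q * (p i + S q))⁻¹ * n, ?_⟩
    have e : (k q * (p i + S q))⁻¹ * (k q * p i * (p i + S q)) = p i := by
      rw [inv_mul_eq_iff_eq_mul₀ hm]
      ring
    rw [mul_smul, ← hn]
    ext
    · simp [slopeVector]
    · simp only [slopeVector, Prod.smul_mk, Prod.mk_add_mk, smul_eq_mul, inv_mul_cancel₀ hm]
      simp
    · simp only [slopeVector, Prod.smul_mk, Prod.mk_add_mk, smul_eq_mul, e]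
      simp

theorem surface_bookletWebEq
    (hmul : ∀ p, P.frobenius.mul p = cubicMul (S p.2) (A p.2) (B p.2) (k p.2))
    (hkD : ∀ q ∈ P.U, k q ^ 2 * (S q * A q - B q) = 1)
    (hS : ContinuousOn S P.U) (hA : ContinuousOn A P.U) (hB : ContinuousOn B P.U)
    (hdense : ∀ q ∈ P.U, ∃ᶠ q' in 𝓝 q, cubicDisc S A B q' ≠ 0) :
    P.surface.BookletWebEq S A B := by
  intro q hq p hp
  have hU : P.U ∈ 𝓝 q := P.isOpen_U.mem_nhds hq
  refine ⟨⟨fun i h0 => one_ne_zero (congrArg Prod.fst h0), ?_, fun N hN => ?_⟩,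
    isRegularBookletTriple_of_isSlopeTriple hmul hkD hq hp⟩
  · rw [mem_closure_iff_frequently]
    refine ((hdense q hq).and_eventually hU).mono fun q' hq' => ⟨hq'.2, ?_⟩
    exact isSemisimpleAt_of_cubicDisc_ne_zero hmul hkD (p := P.surface.ι q') hq'.2 hq'.1
  · have hcont : Continuous fun (r : Fin 3 → ℂ) (i : Fin 3) => ((1 : ℂ), r i) := by fun_prop
    filter_upwards [hp.eventually_exists (hS.continuousAt hU) (hA.continuousAt hU)
      (hB.continuousAt hU) (hcont.continuousAt hN), hU] with q' ⟨p', hp'N, hp'⟩ hq' hss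
    exact ⟨_, hp'N, isRegularBookletTriple_of_isSlopeTriple hmul hkD hq' hp' hss⟩

theorem isMassiveAt_surface
    (hmul : ∀ p, P.frobenius.mul p = cubicMul (S p.2) (A p.2) (B p.2) (k p.2))
    (hkD : ∀ q ∈ P.U, k q ^ 2 * (S q * A q - B q) = 1)
    (hdisc : ContinuousOn (cubicDisc S A B) P.U) {q : ℂ × ℂ} (hq : q ∈ P.U)
    (hdense : ∃ᶠ q' in 𝓝 q, cubicDisc S A B q' ≠ 0) :
    P.frobenius.IsMassiveAt (P.surface.ι q) := by
  refine ⟨Prod.snd ⁻¹' (P.U ∩ cubicDisc S A B ⁻¹' {0}ᶜ), ?_, fun p hp => hp.1, ?_, fun p hp =>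
    isSemisimpleAt_of_cubicDisc_ne_zero hmul hkD hp.1 hp.2⟩
  · exact (hdisc.isOpen_inter_preimage P.isOpen_U isOpen_compl_singleton).preimage continuous_snd
  · have hcl : q ∈ closure (P.U ∩ cubicDisc S A B ⁻¹' {0}ᶜ) := by
      rw [mem_closure_iff_frequently]
      exact (hdense.and_eventually (P.isOpen_U.mem_nhds hq)).mono fun q' hq' => ⟨hq'.2, hq'.1⟩
    refine map_mem_closure (ContinuousLinearMap.inr ℂ ℂ (ℂ × ℂ)).continuous hcl fun q' hq' => ?_
    exact hq'

end Web

end PotentialData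

/-! ### The main theorem -/

theorem mainTheorem4 (S A B : ℂ × ℂ → ℂ) (q₀ : ℂ × ℂ) (wx wy : ℂ)
    (hS : AnalyticAt ℂ S q₀) (hA : AnalyticAt ℂ A q₀) (hB : AnalyticAt ℂ B q₀)
    (hweb : ∃ᶠ q in 𝓝 q₀, IsRegularPoint S A B q)
    (hw : wx ≠ wy)
    (hsymm : IsInfinitesimalSymmetry S A B wx wy q₀)
    (hne : S q₀ * A q₀ - B q₀ ≠ 0)
    (hsys : ∀ᶠ q in 𝓝 q₀, SatisfiesHydrodynamicSystem S A B q) :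
    ∃ (F : FrobeniusStructure (ℂ × ℂ × ℂ)) (W : F.TransverseSurface),
      q₀ ∈ W.U ∧
      F.IsMassiveAt (W.ι q₀) ∧
      (∀ p ∈ F.carrier, F.metric p (F.unity p) (F.unity p) = 1) ∧
      W.BookletWebEq S A B ∧
      ∀ q ∈ W.U, F.euler (W.ι q) - fderiv ℂ W.ι q (diagField wx wy q) ∈
        Submodule.span ℂ ({F.unity (W.ι q)} : Set (ℂ × ℂ × ℂ)) := by
  obtain ⟨k, hk, hkD⟩ := exists_analyticAt_sq_mul_eq_one ((hS.mul hA).sub hB) hne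
  have hsymm' : ∀ᶠ q in 𝓝 q₀, ∀ᶠ τ in 𝓝 (0 : ℂ), ∀ v, IsSolutionDirection S A B q v ↔
      IsSolutionDirection S A B (diagFlow wx wy τ q) (fderiv ℂ (diagFlow wx wy τ) q v) := by
    have h := (continuous_swap.tendsto (q₀, (0 : ℂ))).eventually hsymm
    exact h.curry_nhds
  -- All local conditions are put on one ball, whose connectedness lets the identity theorem make
  -- regular points dense in it.
  obtain ⟨r, hr, hball⟩ := Metric.eventually_nhds_iff_ball.1
    (hS.eventually_analyticAt.and (hA.eventually_analyticAt.and (hB.eventually_analyticAt.and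
      (hk.eventually_analyticAt.and (hkD.and (hsys.and hsymm'))))))
  have hSU : AnalyticOnNhd ℂ S (Metric.ball q₀ r) := fun q hq => (hball q hq).1
  have hAU : AnalyticOnNhd ℂ A (Metric.ball q₀ r) := fun q hq => (hball q hq).2.1
  have hBU : AnalyticOnNhd ℂ B (Metric.ball q₀ r) := fun q hq => (hball q hq).2.2.1
  have hkU : AnalyticOnNhd ℂ k (Metric.ball q₀ r) := fun q hq => (hball q hq).2.2.2.1
  have hdisc : AnalyticOnNhd ℂ (cubicDisc S A B) (Metric.ball q₀ r) :=
    (((((hSU.pow 2).mul (hAU.pow 2)).sub (analyticOnNhd_const.mul (hAU.pow 3))).sub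
      ((analyticOnNhd_const.mul (hSU.pow 3)).mul hBU)).sub
      (analyticOnNhd_const.mul (hBU.pow 2))).add
      (((analyticOnNhd_const.mul hSU).mul hAU).mul hBU)
  have hdense : ∀ q ∈ Metric.ball q₀ r, ∃ᶠ q' in 𝓝 q, cubicDisc S A B q' ≠ 0 := fun q hq =>
    frequently_ne_zero_of_mem_ball hdisc (hweb.mono fun _ h => isRegularPoint_iff.1 h) hq
  have hX : Continuous (diagField wx wy) := by
    unfold diagField
    fun_prop
  -- Homogeneity is a closed condition, so it extends from regular points across the zero set of the
  -- discriminant.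
  have hext : ∀ (f : ℂ × ℂ → ℂ) (m : ℂ), AnalyticOnNhd ℂ f (Metric.ball q₀ r) →
      (∀ q ∈ Metric.ball q₀ r, IsRegularPoint S A B q →
        fderiv ℂ f q (diagField wx wy q) = m * f q) →
      ∀ q ∈ Metric.ball q₀ r, fderiv ℂ f q (diagField wx wy q) = m * f q := by
    intro f m hf hreg q hq
    refine eq_of_frequently_eq ((hf.fderiv q hq).continuousAt.clm_apply hX.continuousAt)
      (continuousAt_const.mul (hf q hq).continuousAt) ?_
    refine ((hdense q hq).and_eventually (Metric.isOpen_ball.mem_nhds hq)).mono fun q' hq' => ?_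
    exact hreg q' hq'.2 (isRegularPoint_iff.2 hq'.1)
  have hreg : ∀ q ∈ Metric.ball q₀ r, IsRegularPoint S A B q → _ := fun q hq h =>
    fderiv_diagField_of_isRegularPoint (wx := wx) (wy := wy) (hSU q hq).differentiableAt
      (hAU q hq).differentiableAt (hBU q hq).differentiableAt h (hball q hq).2.2.2.2.2.2
  have hom := fun q hq => And.intro
    (hext S _ hSU (fun q hq h => (hreg q hq h).1) q hq) (And.intro
    (hext A _ hAU (fun q hq h => (hreg q hq h).2.1) q hq)
    (hext B _ hBU (fun q hq h => (hreg q hq h).2.2) q hq))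
  have hkDU : ∀ q ∈ Metric.ball q₀ r, k q ^ 2 * (S q * A q - B q) = 1 := fun q hq =>
    (hball q hq).2.2.2.2.1
  let P := PotentialData.ofCubic Metric.isOpen_ball hSU hAU hBU hkU hkDU
    (fun q hq => (hball q hq).2.2.2.2.2.1) hom
  have hmul : ∀ p, P.frobenius.mul p = cubicMul (S p.2) (A p.2) (B p.2) (k p.2) := fun _ => rfl
  have hq₀ : q₀ ∈ Metric.ball q₀ r := Metric.mem_ball_self hr
  refine ⟨P.frobenius, P.surface, hq₀, ?_, fun p _ => ?_, ?_, fun q _ => P.euler_sub_mem q⟩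
  · exact PotentialData.isMassiveAt_surface hmul hkDU hdisc.continuousOn hq₀ (hdense q₀ hq₀)
  · change nullMetric (1, 0, 0) (1, 0, 0) = 1
    simp
  · exact PotentialData.surface_bookletWebEq hmul hkDU hSU.continuousOn hAU.continuousOn
      hBU.continuousOn hdense
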